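/- Let $a,q$ be complex numbers with $|q|<1$, put $(a;q)_\infty=\prod_{n\ge 0}(1-aq^n)$, and suppose that $(a;q)_\infty\neq 0$. Then the infinite products $(\pm a;q)_\infty$ converge, and the following continued fraction converges with $$\left(\frac{(-a;q)_\infty}{(a;q)_\infty}\right)^2=-1+\frac{2}{1-}\,\frac{2a}{1-q+}\,\frac{a^2(1+q)^2}{1-q^3+}\,\frac{a^2q(1+q^2)^2}{1-q^5+}\,\frac{a^2q^2(1+q^3)^2}{1-q^7+}\cdots .$$ Equivalently, $$\left(\frac{(-a;q)_\infty}{(a;q)_\infty}\right)^2=-1+\frac{2}{1-u(a,q)},$$ where $$u(a,q)=\frac{2a}{1-q+}\,\frac{a^2(1+q)^2}{1-q^3+}\,\frac{a^2q(1+q^2)^2}{1-q^5+}\,\frac{a^2q^2(1+q^3)^2}{1-q^7+}\cdots$$ is the case $b=-a$ of Ramanujan's continued fraction $$\frac{a-b}{1-q+}\,\frac{(a-bq)(aq-b)}{1-q^3+}\,\frac{q(a-bq^2)(aq^2-b)}{1-q^5+}\,\frac{q^2(a-bq^3)(aq^3-b)}{1-q^7+}\cdots .$$ In detail: if the left-hand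 side is not $-1$, then $u(a,q)$ converges to a finite value different from $1$ and the last identity holds; if the left-hand side equals $-1$, then the convergents of $u(a,q)$ tend to $\infty$ on the Riemann sphere, and the right-hand side is read as $-1$. -/

import Mathlib

open Filter Topology

noncomputable section

/-- The infinite `q`-shifted factorial `(a; q)_∞ = ∏_{n ≥ 0} (1 - a q ^ n)`. -/
def qPochInf (a q : ℂ) : ℂ := ∏' n : ℕ, (1 - a * q ^ n)

/-- The infinite continued fraction `b₀ + x 0 / (y 0 + x 1 / (y 1 + x 2 / (y 2 + ⋯)))`. -/
def cfrac (b₀ : ℂ) (x y : ℕ → ℂ) : GenContFract ℂ :=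
  ⟨b₀, Stream'.Seq.ofStream fun n => ⟨x n, y n⟩⟩

/-- The continued fraction `g` converges to the finite value `v`: with `Aₙ`, `Bₙ` its continuants,
all but finitely many of the convergents `Aₙ / Bₙ` are defined, and they tend to `v`. -/
def CFracHasValue (g : GenContFract ℂ) (v : ℂ) : Prop :=
  (∀ᶠ n in atTop, g.dens n ≠ 0) ∧ Tendsto (fun n => g.nums n / g.dens n) atTop (𝓝 v)

/-- The continued fraction `g` has the value `∞` on the Riemann sphere: the reciprocals
`Bₙ / Aₙ` of the convergents are eventually defined and tend to `0`. -/
def CFracHasValueInfty (g : GenContFract ℂ) : Prop :=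
  (∀ᶠ n in atTop, g.nums n ≠ 0) ∧ Tendsto (fun n => g.dens n / g.nums n) atTop (𝓝 0)

/-- Partial numerators of Ramanujan's continued fraction:
`a - b`, `(a - b q)(a q - b)`, `q (a - b q²)(a q² - b)`, `q² (a - b q³)(a q³ - b)`, … -/
def ramanujanNum (a b q : ℂ) : ℕ → ℂ
  | 0 => a - b
  | k + 1 => q ^ k * (a - b * q ^ (k + 1)) * (a * q ^ (k + 1) - b)

/-- Ramanujan's continued fraction
`(a - b)/(1 - q +) (a - b q)(a q - b)/(1 - q³ +) q (a - b q²)(a q² - b)/(1 - q⁵ +) ⋯`. -/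
def ramanujanCF (a b q : ℂ) : GenContFract ℂ :=
  cfrac 0 (ramanujanNum a b q) (fun k => 1 - q ^ (2 * k + 1))

/-- Partial numerators `2 a`, `a² (1 + q)²`, `a² q (1 + q²)²`, `a² q² (1 + q³)²`, … of `u(a, q)`. -/
def uNum (a q : ℂ) : ℕ → ℂ
  | 0 => 2 * a
  | k + 1 => a ^ 2 * q ^ k * (1 + q ^ (k + 1)) ^ 2

/-- The continued fraction
`u(a, q) = 2a/(1 - q +) a²(1 + q)²/(1 - q³ +) a² q (1 + q²)²/(1 - q⁵ +) ⋯`. -/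
def uCF (a q : ℂ) : GenContFract ℂ :=
  cfrac 0 (uNum a q) (fun k => 1 - q ^ (2 * k + 1))

/-- Partial numerators of `-1 + 2/(1 - u(a, q))`, written out as one continued fraction. -/
def fullNum (a q : ℂ) : ℕ → ℂ
  | 0 => 2
  | 1 => -(2 * a)
  | k + 2 => a ^ 2 * q ^ k * (1 + q ^ (k + 1)) ^ 2

/-- Partial denominators of `-1 + 2/(1 - u(a, q))`, written out as one continued fraction. -/
def fullDen (q : ℂ) : ℕ → ℂ
  | 0 => 1
  | k + 1 => 1 - q ^ (2 * k + 1)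

/-- The continued fraction
`-1 + 2/(1 -) 2a/(1 - q +) a²(1 + q)²/(1 - q³ +) a² q (1 + q²)²/(1 - q⁵ +) ⋯`. -/
def fullCF (a q : ℂ) : GenContFract ℂ := cfrac (-1) (fullNum a q) (fullDen q)

end

/-! With `Aₙ / Bₙ` the convergents of `u(a, q)`, let `Pₙ(a) = Aₙ + Bₙ`. The recurrence involves `a`
only through `a²`, and `Pₙ(-a) = Bₙ - Aₙ`, so `-1 + 2/(1 - u)` has convergents `Pₙ(a) / Pₙ(-a)`. The
recurrence is a summable perturbation of `Pₙ₊₂ = Pₙ₊₁`, hence `Pₙ(a)` has a limit `P(a)`. The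
Bauer–Muir identity `contSum_mul_q` becomes `P(a) = (1 + a)² P(aq)`, and iterating it gives `P(a) =
(-a; q)_∞² P(0)` with `P(0) = ∏ (1 - q^(2k+1)) ≠ 0`. In the quotient `P(a) / P(-a)` the factor
`P(0)` cancels. -/

/-- The polynomials `Aₙ + Bₙ`, where `Aₙ / Bₙ` are the convergents of `u(a, q)`. -/
def contSum (q a : ℂ) : ℕ → ℂ
  | 0 => 1
  | 1 => 1 - q + 2 * a
  | n + 2 => (1 - q ^ (2 * n + 3)) * contSum q a (n + 1)
      + a ^ 2 * q ^ n * (1 + q ^ (n + 1)) ^ 2 * contSum q a n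

lemma contSum_add_two (q a : ℂ) (n : ℕ) :
    contSum q a (n + 2) = (1 - q ^ (2 * n + 3)) * contSum q a (n + 1)
      + a ^ 2 * q ^ n * (1 + q ^ (n + 1)) ^ 2 * contSum q a n := rfl

/-- The Bauer–Muir transformation relating the continuants at `a` and at `a q`. -/
lemma contSum_mul_q (q a : ℂ) (n : ℕ) :
    (1 + a) ^ 2 * contSum q (a * q) (n + 1) = (1 + a ^ 2 * q ^ (n + 1)) * contSum q a (n + 1)
      + a ^ 2 * q ^ n * (1 + q ^ (n + 1)) ^ 2 * contSum q a n := by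
  induction n using Nat.twoStepInduction with
  | zero => simp only [contSum]; ring
  | one => simp only [contSum]; ring
  | more n h₀ h₁ =>
    rw [contSum_add_two q (a * q) (n + 1), contSum_add_two q a (n + 1)]
    rw [contSum_add_two q a n] at h₁ ⊢
    -- The weights are the coefficients of the recurrence at `a * q`: both sides of the identity
    -- satisfy that recurrence.
    linear_combination (1 - q ^ (2 * (n + 1) + 3)) * h₁
      + (a * q) ^ 2 * q ^ (n + 1) * (1 + q ^ (n + 1 + 1)) ^ 2 * h₀

/-! ### Convergence of the continuants, uniform on discs -/

/-- The size of the perturbation in the recurrence for `contSum`. -/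
noncomputable def contErr (q : ℂ) (R : ℝ) (n : ℕ) : ℝ := (1 + 4 * R ^ 2) * ‖q‖ ^ n

lemma contErr_nonneg (q : ℂ) (R : ℝ) (n : ℕ) : 0 ≤ contErr q R n := by
  unfold contErr; positivity

lemma summable_contErr {q : ℂ} (hq : ‖q‖ < 1) (R : ℝ) : Summable (contErr q R) :=
  (summable_geometric_of_lt_one (norm_nonneg q) hq).mul_left _

lemma norm_contSum_sub_le {q a : ℂ} {R M : ℝ} (hq : ‖q‖ < 1) (ha : ‖a‖ ≤ R) (n : ℕ)
    (h₀ : ‖contSum q a n‖ ≤ M) (h₁ : ‖contSum q a (n + 1)‖ ≤ M) :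
    ‖contSum q a (n + 2) - contSum q a (n + 1)‖ ≤ contErr q R n * M := by
  have hM : 0 ≤ M := (norm_nonneg _).trans h₀
  have hpow : ‖q ^ (2 * n + 3)‖ ≤ ‖q‖ ^ n := by
    rw [norm_pow]
    exact pow_le_pow_of_le_one (norm_nonneg q) hq.le (by omega)
  have hone : ‖1 + q ^ (n + 1)‖ ≤ 2 := by
    refine (norm_add_le _ _).trans ?_
    rw [norm_one, norm_pow]
    linarith [pow_le_one₀ (n := n + 1) (norm_nonneg q) hq.le]
  have hcoef : ‖a ^ 2 * q ^ n * (1 + q ^ (n + 1)) ^ 2‖ ≤ R ^ 2 * ‖q‖ ^ n * 2 ^ 2 := by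
    rw [norm_mul, norm_mul, norm_pow, norm_pow, norm_pow]
    gcongr
  rw [contSum_add_two, show (1 - q ^ (2 * n + 3)) * contSum q a (n + 1)
      + a ^ 2 * q ^ n * (1 + q ^ (n + 1)) ^ 2 * contSum q a n - contSum q a (n + 1)
      = a ^ 2 * q ^ n * (1 + q ^ (n + 1)) ^ 2 * contSum q a n
        - q ^ (2 * n + 3) * contSum q a (n + 1) by ring]
  refine (norm_sub_le _ _).trans ?_
  rw [norm_mul, norm_mul (q ^ _)]
  -- The two terms account for the `4 * R ^ 2` and the `1` in `contErr`.
  calc _ ≤ R ^ 2 * ‖q‖ ^ n * 2 ^ 2 * M + ‖q‖ ^ n * M := by gcongr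
    _ = contErr q R n * M := by unfold contErr; ring

/-- Discrete Grönwall: each step enlarges the bound by at most `1 + contErr q R n ≤ exp (contErr q R
n)`. The factor `2 + 2 * R` bounds the two initial values. -/
lemma norm_contSum_le_exp_sum {q a : ℂ} {R : ℝ} (hq : ‖q‖ < 1) (ha : ‖a‖ ≤ R) (n : ℕ) :
    ‖contSum q a n‖ ≤ (2 + 2 * R) * Real.exp (∑ k ∈ Finset.range n, contErr q R k) ∧
    ‖contSum q a (n + 1)‖ ≤ (2 + 2 * R) * Real.exp (∑ k ∈ Finset.range n, contErr q R k) := by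
  have hR : 0 ≤ R := (norm_nonneg a).trans ha
  induction n with
  | zero =>
    simp only [contSum, Finset.range_zero, Finset.sum_empty, Real.exp_zero, mul_one, norm_one]
    refine ⟨by linarith, (norm_add_le _ _).trans ?_⟩
    have := norm_sub_le (1 : ℂ) q
    rw [norm_one] at this
    rw [norm_mul, Complex.norm_ofNat]
    linarith
  | succ n ih =>
    obtain ⟨h₀, h₁⟩ := ih
    have hd := norm_contSum_sub_le hq ha n h₀ h₁
    have he := contErr_nonneg q R n
    rw [Finset.sum_range_succ, Real.exp_add, ← mul_assoc]
    set M := (2 + 2 * R) * Real.exp (∑ k ∈ Finset.range n, contErr q R k)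
    have hM : 0 ≤ M := by positivity
    have hexp : M * (contErr q R n + 1) ≤ M * Real.exp (contErr q R n) :=
      mul_le_mul_of_nonneg_left (Real.add_one_le_exp _) hM
    have htri := norm_add_le (contSum q a (n + 2) - contSum q a (n + 1)) (contSum q a (n + 1))
    rw [sub_add_cancel] at htri
    constructor <;> nlinarith [mul_nonneg hM he]

lemma exists_norm_contSum_sub_le {q : ℂ} (hq : ‖q‖ < 1) (R : ℝ) :
    ∃ M : ℝ, ∀ a : ℂ, ‖a‖ ≤ R → ∀ n,
      ‖contSum q a (n + 2) - contSum q a (n + 1)‖ ≤ contErr q R n * M := by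
  refine ⟨(2 + 2 * R) * Real.exp (∑' k, contErr q R k), fun a ha n => ?_⟩
  have hR : 0 ≤ R := (norm_nonneg a).trans ha
  have hle : (2 + 2 * R) * Real.exp (∑ k ∈ Finset.range n, contErr q R k)
      ≤ (2 + 2 * R) * Real.exp (∑' k, contErr q R k) := by
    gcongr
    exact (summable_contErr hq R).sum_le_tsum _ fun k _ => contErr_nonneg q R k
  obtain ⟨h₀, h₁⟩ := norm_contSum_le_exp_sum hq ha n
  exact norm_contSum_sub_le hq ha n (h₀.trans hle) (h₁.trans hle)

/-- The limit of `contSum q a n` as `n → ∞`. -/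
noncomputable def contLim (q a : ℂ) : ℂ :=
  contSum q a 1 + ∑' n, (contSum q a (n + 2) - contSum q a (n + 1))

lemma tendsto_contSum {q : ℂ} (hq : ‖q‖ < 1) (a : ℂ) :
    Tendsto (contSum q a) atTop (𝓝 (contLim q a)) := by
  obtain ⟨M, hM⟩ := exists_norm_contSum_sub_le hq ‖a‖
  have hs : Summable fun n => contSum q a (n + 2) - contSum q a (n + 1) :=
    ((summable_contErr hq ‖a‖).mul_right M).of_norm_bounded (hM a le_rfl)
  have ht := hs.hasSum.tendsto_sum_nat.const_add (contSum q a 1)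
  rw [← tendsto_add_atTop_iff_nat 1]
  refine ht.congr fun n => ?_
  rw [Finset.sum_range_sub (fun n => contSum q a (n + 1))]
  ring

lemma continuous_contSum (q : ℂ) (n : ℕ) : Continuous fun a => contSum q a n := by
  induction n using Nat.twoStepInduction with
  | zero => simp only [contSum]; fun_prop
  | one => simp only [contSum]; fun_prop
  | more n h₀ h₁ => simp only [contSum_add_two]; fun_prop

/-- All points `a * q ^ m` lie in the disc of radius `‖a‖`, where one summable majorant serves the
telescoping series, so dominated convergence applies. -/
lemma tendsto_contLim_mul_pow {q : ℂ} (hq : ‖q‖ < 1) (a : ℂ) :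
    Tendsto (fun m : ℕ => contLim q (a * q ^ m)) atTop (𝓝 (contLim q 0)) := by
  obtain ⟨M, hM⟩ := exists_norm_contSum_sub_le hq ‖a‖
  have harg : Tendsto (fun m : ℕ => a * q ^ m) atTop (𝓝 0) := by
    simpa using (tendsto_pow_atTop_nhds_zero_of_norm_lt_one hq).const_mul a
  have hn (n : ℕ) : Tendsto (fun m : ℕ => contSum q (a * q ^ m) n) atTop (𝓝 (contSum q 0 n)) :=
    ((continuous_contSum q n).tendsto 0).comp harg
  refine (hn 1).add (tendsto_tsum_of_dominated_convergence
    ((summable_contErr hq ‖a‖).mul_right M) (fun n => (hn _).sub (hn _))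
    (Eventually.of_forall fun m n => hM _ ?_ n))
  rw [norm_mul, norm_pow]
  exact mul_le_of_le_one_right (norm_nonneg a) (pow_le_one₀ (norm_nonneg q) hq.le)

/-! ### Functional equation and product formula for the limit -/

lemma contLim_mul_q {q : ℂ} (hq : ‖q‖ < 1) (a : ℂ) :
    contLim q a = (1 + a) ^ 2 * contLim q (a * q) := by
  have hpow := tendsto_pow_atTop_nhds_zero_of_norm_lt_one hq
  have hpow' := hpow.comp (tendsto_add_atTop_nat 1)
  have hP := tendsto_contSum hq a
  have hP' := hP.comp (tendsto_add_atTop_nat 1)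
  have hl := ((tendsto_contSum hq (a * q)).comp (tendsto_add_atTop_nat 1)).const_mul ((1 + a) ^ 2)
  have hr := (((hpow'.const_mul (a ^ 2)).const_add 1).mul hP').add
    (((hpow.const_mul (a ^ 2)).mul ((hpow'.const_add 1).pow 2)).mul hP)
  have := tendsto_nhds_unique (hl.congr fun n => contSum_mul_q q a n) hr
  rw [this]
  ring

lemma contLim_eq_prod_mul {q : ℂ} (hq : ‖q‖ < 1) (a : ℂ) (m : ℕ) :
    contLim q a = (∏ k ∈ Finset.range m, (1 - -a * q ^ k)) ^ 2 * contLim q (a * q ^ m) := by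
  induction m with
  | zero => simp
  | succ m ih =>
    rw [ih, contLim_mul_q hq (a * q ^ m), Finset.prod_range_succ, pow_succ q m, ← mul_assoc a]
    ring

lemma multipliable_one_sub_mul_pow {q : ℂ} (hq : ‖q‖ < 1) (a : ℂ) :
    Multipliable fun n : ℕ => 1 - a * q ^ n := by
  simp only [sub_eq_add_neg]
  refine multipliable_one_add_of_summable ?_
  simpa using (summable_geometric_of_lt_one (norm_nonneg q) hq).mul_left ‖a‖

lemma contLim_eq {q : ℂ} (hq : ‖q‖ < 1) (a : ℂ) :
    contLim q a = qPochInf (-a) q ^ 2 * contLim q 0 := by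
  have h := ((multipliable_one_sub_mul_pow hq (-a)).tendsto_prod_tprod_nat.pow 2).mul
    (tendsto_contLim_mul_pow hq a)
  exact tendsto_nhds_unique (tendsto_const_nhds.congr (contLim_eq_prod_mul hq a)) h

lemma contSum_zero_eq_prod (q : ℂ) (n : ℕ) :
    contSum q 0 n = ∏ k ∈ Finset.range n, (1 - q ^ (2 * k + 1)) := by
  induction n using Nat.twoStepInduction with
  | zero => simp [contSum]
  | one => simp [contSum]
  | more n _ h =>
    rw [contSum_add_two, h, Finset.prod_range_succ _ (n + 1)]
    ring

/-- At `a = 0` the limit is an absolutely convergent product without zero factors. -/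
lemma contLim_zero_ne_zero {q : ℂ} (hq : ‖q‖ < 1) : contLim q 0 ≠ 0 := by
  have hs : Summable fun n : ℕ => ‖-q ^ (2 * n + 1)‖ := by
    refine (summable_geometric_of_lt_one (norm_nonneg q) hq).of_nonneg_of_le
      (fun _ => norm_nonneg _) fun n => ?_
    rw [norm_neg, norm_pow]
    exact pow_le_pow_of_le_one (norm_nonneg q) hq.le (by omega)
  have hne (n : ℕ) : 1 + -q ^ (2 * n + 1) ≠ 0 := by
    intro h
    have h1 : q ^ (2 * n + 1) = 1 := by linear_combination -h
    have h2 := pow_lt_one₀ (norm_nonneg q) hq (show 2 * n + 1 ≠ 0 by omega)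
    rw [← norm_pow, h1, norm_one] at h2
    exact lt_irrefl _ h2
  have ht := (multipliable_one_add_of_summable hs).tendsto_prod_tprod_nat
  have hlim := ht.congr fun n => show _ = contSum q 0 n by
    simp only [contSum_zero_eq_prod, sub_eq_add_neg]
  rw [tendsto_nhds_unique (tendsto_contSum hq 0) hlim]
  exact tprod_one_add_ne_zero_of_summable hne hs

/-! ### Continuants of the continued fractions -/

section Continuants

variable (b₀ : ℂ) (x y : ℕ → ℂ)

lemma cfrac_nums_one : (cfrac b₀ x y).nums 1 = y 0 * b₀ + x 0 :=
  GenContFract.first_num_eq (g := cfrac b₀ x y) (gp := ⟨x 0, y 0⟩) rfl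

lemma cfrac_dens_one : (cfrac b₀ x y).dens 1 = y 0 :=
  GenContFract.first_den_eq (g := cfrac b₀ x y) (gp := ⟨x 0, y 0⟩) rfl

lemma cfrac_nums_add_two (n : ℕ) : (cfrac b₀ x y).nums (n + 2) =
    y (n + 1) * (cfrac b₀ x y).nums (n + 1) + x (n + 1) * (cfrac b₀ x y).nums n :=
  GenContFract.nums_recurrence (gp := ⟨x (n + 1), y (n + 1)⟩) rfl rfl rfl

lemma cfrac_dens_add_two (n : ℕ) : (cfrac b₀ x y).dens (n + 2) =
    y (n + 1) * (cfrac b₀ x y).dens (n + 1) + x (n + 1) * (cfrac b₀ x y).dens n :=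
  GenContFract.dens_recurrence (gp := ⟨x (n + 1), y (n + 1)⟩) rfl rfl rfl

end Continuants

lemma uCF_nums (a q : ℂ) (n : ℕ) :
    (uCF a q).nums n = (contSum q a n - contSum q (-a) n) / 2 := by
  induction n using Nat.twoStepInduction with
  | zero => simp [contSum, uCF, cfrac]
  | one => rw [uCF, cfrac_nums_one]; simp only [uNum, contSum]; ring
  | more n h₀ h₁ =>
    rw [uCF] at *
    rw [cfrac_nums_add_two, h₀, h₁, contSum_add_two, contSum_add_two]
    simp only [uNum]
    ring

lemma uCF_dens (a q : ℂ) (n : ℕ) :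
    (uCF a q).dens n = (contSum q a n + contSum q (-a) n) / 2 := by
  induction n using Nat.twoStepInduction with
  | zero => simp [contSum]
  | one => rw [uCF, cfrac_dens_one]; simp only [contSum]; ring
  | more n h₀ h₁ =>
    rw [uCF] at *
    rw [cfrac_dens_add_two, h₀, h₁, contSum_add_two, contSum_add_two]
    simp only [uNum]
    ring

/-- Since `-1 + 2/(1 - A/B) = (B + A)/(B - A)`, prefixing `-1 + 2/(1 - ·)` shifts the index by one
and turns `Aₙ`, `Bₙ` into `Bₙ + Aₙ`, `Bₙ - Aₙ`. -/
lemma fullCF_nums_succ (a q : ℂ) (n : ℕ) : (fullCF a q).nums (n + 1) = contSum q a n := by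
  induction n using Nat.twoStepInduction with
  | zero => rw [fullCF, cfrac_nums_one]; simp only [fullNum, fullDen, contSum]; ring
  | one =>
    rw [fullCF, cfrac_nums_add_two, cfrac_nums_one, GenContFract.zeroth_num_eq_h]
    simp only [fullNum, fullDen, contSum, cfrac]
    ring
  | more n h₀ h₁ =>
    rw [fullCF] at *
    rw [cfrac_nums_add_two, h₀, h₁, contSum_add_two]
    simp only [fullNum, fullDen]
    ring

lemma fullCF_dens_succ (a q : ℂ) (n : ℕ) : (fullCF a q).dens (n + 1) = contSum q (-a) n := by
  induction n using Nat.twoStepInduction with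
  | zero => rw [fullCF, cfrac_dens_one]; simp only [fullDen, contSum]
  | one =>
    rw [fullCF, cfrac_dens_add_two, cfrac_dens_one, GenContFract.zeroth_den_eq_one]
    simp only [fullNum, fullDen, contSum]
    ring
  | more n h₀ h₁ =>
    rw [fullCF] at *
    rw [cfrac_dens_add_two, h₀, h₁, contSum_add_two]
    simp only [fullNum, fullDen]
    ring

lemma ramanujanNum_neg (a q : ℂ) : ramanujanNum a (-a) q = uNum a q := by
  funext n
  cases n <;> simp only [ramanujanNum, uNum] <;> ring

theorem proposition6 (a q : ℂ) (hq : ‖q‖ < 1) (ha : qPochInf a q ≠ 0) :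
    -- both infinite products converge
    Multipliable (fun n : ℕ => 1 - a * q ^ n) ∧
    Multipliable (fun n : ℕ => 1 - (-a) * q ^ n) ∧
    -- `u(a, q)` is the specialization `b = -a` of Ramanujan's continued fraction
    uCF a q = ramanujanCF a (-a) q ∧
    -- the continued fraction `-1 + 2/(1 -) 2a/(1 - q +) ⋯` converges to the squared quotient
    CFracHasValue (fullCF a q) ((qPochInf (-a) q / qPochInf a q) ^ 2) ∧
    -- if the squared quotient is not `-1`, then `u(a, q)` has a finite value `u ≠ 1`
    ((qPochInf (-a) q / qPochInf a q) ^ 2 ≠ -1 →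
      ∃ u : ℂ, CFracHasValue (uCF a q) u ∧ u ≠ 1 ∧
        (qPochInf (-a) q / qPochInf a q) ^ 2 = -1 + 2 / (1 - u)) ∧
    -- if it is `-1`, then `u(a, q) = ∞`, so that `-1 + 2 / (1 - u) = -1` in the usual sense
    ((qPochInf (-a) q / qPochInf a q) ^ 2 = -1 → CFracHasValueInfty (uCF a q)) := by
  have hL := contLim_zero_ne_zero hq
  have hA := tendsto_contSum hq a
  have hB := tendsto_contSum hq (-a)
  rw [contLim_eq hq] at hA hB
  rw [neg_neg] at hB
  have hnum := ((hA.sub hB).div_const 2).congr fun n => (uCF_nums a q n).symm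
  have hden := ((hA.add hB).div_const 2).congr fun n => (uCF_dens a q n).symm
  set A := qPochInf (-a) q
  set B := qPochInf a q
  set L := contLim q 0
  have hB2 : B ^ 2 ≠ 0 := pow_ne_zero 2 ha
  refine ⟨multipliable_one_sub_mul_pow hq a, multipliable_one_sub_mul_pow hq (-a), ?_, ?_, ?_, ?_⟩
  · rw [uCF, ramanujanCF, ramanujanNum_neg]
  · have hBL : B ^ 2 * L ≠ 0 := mul_ne_zero hB2 hL
    constructor
    · rw [← map_add_atTop_eq_nat 1, eventually_map]
      simpa only [fullCF_dens_succ] using hB.eventually_ne hBL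
    · rw [← tendsto_add_atTop_iff_nat 1]
      simp only [fullCF_dens_succ, fullCF_nums_succ]
      rw [show (A / B) ^ 2 = A ^ 2 * L / (B ^ 2 * L) by field_simp]
      exact hA.div hB hBL
  · intro h
    have hsum : A ^ 2 + B ^ 2 ≠ 0 := fun h0 => h <| by
      field_simp
      linear_combination h0
    have hlim : (A ^ 2 * L + B ^ 2 * L) / 2 ≠ 0 := by
      rw [← add_mul]
      exact div_ne_zero (mul_ne_zero hsum hL) two_ne_zero
    -- This closed form of `1 - u` is nonzero as `B ≠ 0`, so it gives both `u ≠ 1` and the identity.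
    have hu : 1 - (A ^ 2 * L - B ^ 2 * L) / 2 / ((A ^ 2 * L + B ^ 2 * L) / 2)
        = 2 * B ^ 2 / (A ^ 2 + B ^ 2) := by
      rw [← add_mul, ← sub_mul]
      field_simp
      ring
    refine ⟨_, ⟨hden.eventually_ne hlim, hnum.div hden hlim⟩, fun h1 => ?_, ?_⟩
    · rw [h1, sub_self] at hu
      exact div_ne_zero (mul_ne_zero two_ne_zero hB2) hsum hu.symm
    · rw [hu]
      field_simp
      ring
  · intro h
    have hAB : A ^ 2 = -B ^ 2 := by
      field_simp at h
      exact h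
    -- Now the denominators tend to `0` and the numerators to `-(B ^ 2 * L) ≠ 0`.
    rw [hAB] at hnum hden
    have hlim : (-B ^ 2 * L - B ^ 2 * L) / 2 ≠ 0 := by
      rw [show (-B ^ 2 * L - B ^ 2 * L) / 2 = -(B ^ 2 * L) by ring]
      exact neg_ne_zero.mpr (mul_ne_zero hB2 hL)
    refine ⟨hnum.eventually_ne hlim, ?_⟩
    rw [show (0 : ℂ) = (-B ^ 2 * L + B ^ 2 * L) / 2 / ((-B ^ 2 * L - B ^ 2 * L) / 2) by ring]
    exact hden.div hnum hlim
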